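/- Let $A\in\mathbb R^{n\times n}$, $B\in\mathbb R^{n\times m}$, $C\in\mathbb R^{p\times n}$, let $\Phi:[0,\infty)\times\mathbb R^p\to\mathbb R^m$ be continuous and differentiable in $y$ with Jacobian $J_\Phi(t,y)=\frac{\partial\Phi}{\partial y}(t,y)$ continuous in $(t,y)$ (e.g. $\Phi\in C^1$), and consider the Lurie system $\dot x=f(t,x):=Ax-B\Phi(t,Cx)$, $t\ge 0$. Fix an integer $1\le k\le n$. For a matrix $M$ let $M^{(k)}$ denote its $k$-multiplicative compound (the matrix of all minors of order $k$), and for a square matrix $M$ let $M^{[k]}:=\frac{d}{d\varepsilon}(I+\varepsilon M)^{(k)}\big|_{\varepsilon=0}$ denote its $k$-additive compound. Let $\sigma_1$ denote the largest singular value. Suppose that $\sigma_1(J_\Phi(t,y))\le q$ for all $t\ge 0$, $y\in\mathbb R^p$, and that there are $\eta_1>0$ and $P=QQ$, with $Q\succ 0$, such that $$P^{(k)}A^{[k]}+(A^{[k]})^TP^{(k)}+\eta_1P^{(k)}+Q^{(k)}\left(c\,(QBB^TQ)^{[k]}+(Q^{-1}C^TCQ^{-1})^{[k]}\right)Q^{(k)}\preceq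 0,$$ where either $c=q^2$, or $q\ge 1$ and $c=q^{2k}$. Then the Lurie system is $k$-contractive with rate $\eta_1/2$ with respect to the scaled norm $|z|_{2,Q^{(k)}}=|Q^{(k)}z|_2$: if $D\subseteq\mathbb R^k$ is a set on which derivatives within $D$ are unique (e.g. open, or convex with nonempty interior), $0\le t_0\le t_1$, and $x(\cdot,r)$, $r\in D$, are solutions on $[t_0,t_1]$ whose initial values $x(t_0,r)$ depend differentiably on $r$, then for every $t\in[t_0,t_1]$ the map $r\mapsto x(t,r)$ is differentiable on $D$, and $W(t,r):=\left[\frac{\partial x}{\partial r_1}(t,r)\ \cdots\ \frac{\partial x}{\partial r_k}(t,r)\right]$ satisfies $$|W(t,r)^{(k)}|_{2,Q^{(k)}}\le e^{-\frac{\eta_1}{2}(t-t_0)}\,|W(t_0,r)^{(k)}|_{2,Q^{(k)}}\quad\text{for all } r\in D.$$ Moreover, with $J:=\frac{\partial f}{\partial x}$, the matrix measure induced by $|\cdot|_{2,Q^{(k)}}$ satisfies $\mu_{2,Q^{(k)}}(J^{[k]}(t,x))\le-\eta_1/2$ for all $t\ge 0$, $x\in\mathbb R^n$. -/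

import Mathlib

open Set Filter Topology Matrix

noncomputable section

namespace Lurie

/-- `ℝⁿ` with the Euclidean norm. -/
abbrev Vec (n : ℕ) : Type := EuclideanSpace ℝ (Fin n)

/-- Strictly increasing sequences of `k` indices out of `n`. They index the rows and columns of
the `k`-compounds; the lexicographic numbering of these sequences plays no role, since matrices
may be indexed by any finite type. -/
abbrev Seq (k n : ℕ) : Type := Fin k ↪o Fin n

instance (k n : ℕ) : Fintype (Seq k n) :=
  Fintype.ofInjective (fun κ : Seq k n => (κ : Fin k → Fin n)) DFunLike.coe_injective

/-- The `k`-multiplicative compound `A^{(k)}`: the matrix of all minors of order `k`. -/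
def mulCompound {n m : ℕ} (k : ℕ) (A : Matrix (Fin n) (Fin m) ℝ) :
    Matrix (Seq k n) (Seq k m) ℝ :=
  Matrix.of fun κ l => (A.submatrix κ l).det

/-- The `k`-additive compound `A^{[k]} = d/dε (I + ε A)^{(k)}` at `ε = 0` (entrywise derivative of
polynomials in `ε`). -/
def addCompound {n : ℕ} (k : ℕ) (A : Matrix (Fin n) (Fin n) ℝ) :
    Matrix (Seq k n) (Seq k n) ℝ :=
  Matrix.of fun κ l => deriv (fun ε : ℝ => mulCompound k (1 + ε • A) κ l) 0

/-- The column vector `X^{(k)}` of an `n × k` matrix, that is, the coordinates of the wedge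
product of its `k` columns; its Euclidean norm is the `k`-volume of the parallelotope that the
columns span. -/
def wedgeColumns {n k : ℕ} (X : Matrix (Fin n) (Fin k) ℝ) : Seq k n → ℝ :=
  fun κ => mulCompound k X κ (RelEmbedding.refl _)

/-- The scaled `L₂` norm `|z|_{2,H} = |H z|₂`. -/
def scaledNorm {ι : Type} [Fintype ι] (H : Matrix ι ι ℝ) (z : ι → ℝ) : ℝ :=
  ‖WithLp.toLp 2 (H *ᵥ z)‖

/-- The matrix norm induced by the vector norm `N`. -/
def inducedNorm {ι : Type} [Fintype ι] (N : (ι → ℝ) → ℝ) (A : Matrix ι ι ℝ) : ℝ :=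
  sSup {a : ℝ | ∃ z : ι → ℝ, N z = 1 ∧ a = N (A *ᵥ z)}

/-- `μ` is the value at `A` of the matrix measure (logarithmic norm) induced by the vector
norm `N`. -/
def IsMatrixMeasure {ι : Type} [Fintype ι] [DecidableEq ι] (N : (ι → ℝ) → ℝ)
    (A : Matrix ι ι ℝ) (μ : ℝ) : Prop :=
  Tendsto (fun ε : ℝ => (inducedNorm N (1 + ε • A) - 1) / ε) (𝓝[>] 0) (𝓝 μ)

/-- The Jacobian matrix of `g` at `x`. -/
def jacobian {n m : ℕ} (g : Vec n → Vec m) (x : Vec n) : Matrix (Fin m) (Fin n) ℝ :=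
  Matrix.of fun i j => fderiv ℝ g x (EuclideanSpace.single j 1) i

/-- The Jacobian matrix of `g` at `x`, computed within the set `D`. -/
def jacobianWithin {n m : ℕ} (g : Vec n → Vec m) (D : Set (Vec n)) (x : Vec n) :
    Matrix (Fin m) (Fin n) ℝ :=
  Matrix.of fun i j => fderivWithin ℝ g D x (EuclideanSpace.single j 1) i

/-- The largest singular value `σ₁` of a real matrix. -/
def sigmaOne {n m : ℕ} (A : Matrix (Fin m) (Fin n) ℝ) : ℝ :=
  (Matrix.toEuclideanLin A).singularValues 0

/-- `x` solves `ẋ = f (t, x)` on `[t₀, t₁]`. -/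
def IsSolutionOn {n : ℕ} (f : ℝ → Vec n → Vec n) (t₀ t₁ : ℝ) (x : ℝ → Vec n) : Prop :=
  ∀ t ∈ Icc t₀ t₁, HasDerivWithinAt x (f t (x t)) (Icc t₀ t₁) t

/-- `ẋ = f (t, x)`, `t ≥ 0`, is `k`-contractive with rate `η` with respect to the norm `N` on the
space of `k`-vectors: along the flow, the `k`-volume element of every `k`-dimensional parametrized
body decays at the rate `η`.

The body is carried by a family of trajectories `x r`, `r ∈ D ⊆ ℝᵏ`, which at the initial time
`t₀` depends differentiably on `r`; the simplex parametrizations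
`x r t₀ = ∑ rᵢ aⁱ + (1 - ∑ rᵢ) aᵏ⁺¹` are a special case. Then at every later time `t` it depends
differentiably on `r`, and the matrix `W(t, r) = [∂x/∂r₁ ⋯ ∂x/∂rₖ]` satisfies
`N (W(t, r)^{(k)}) ≤ exp (-η (t - t₀)) N (W(t₀, r)^{(k)})`. The condition `UniqueDiffOn` makes the
partial derivatives within `D` unambiguous; it holds for open sets and for convex sets with
nonempty interior. -/
def IsKContractive {n : ℕ} (k : ℕ) (f : ℝ → Vec n → Vec n) (N : (Seq k n → ℝ) → ℝ) (η : ℝ) :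
    Prop :=
  0 < η ∧
  ∀ (D : Set (Vec k)), UniqueDiffOn ℝ D →
  ∀ t₀ t₁ : ℝ, 0 ≤ t₀ →
  ∀ x : Vec k → ℝ → Vec n,
    (∀ r ∈ D, IsSolutionOn f t₀ t₁ (x r)) →
    DifferentiableOn ℝ (fun r => x r t₀) D →
    ∀ t ∈ Icc t₀ t₁,
      DifferentiableOn ℝ (fun r => x r t) D ∧
      ∀ r ∈ D,
        N (wedgeColumns (jacobianWithin (fun s => x s t) D r)) ≤
          Real.exp (-η * (t - t₀)) *
            N (wedgeColumns (jacobianWithin (fun s => x s t₀) D r))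

/-- The vector field `A x - B Φ(t, C x)` of the closed-loop Lurie system. -/
def lurieField {n m p : ℕ} (A : Matrix (Fin n) (Fin n) ℝ) (B : Matrix (Fin n) (Fin m) ℝ)
    (C : Matrix (Fin p) (Fin n) ℝ) (Φ : ℝ → Vec p → Vec m) : ℝ → Vec n → Vec n :=
  fun t x => Matrix.toEuclideanLin A x -
    Matrix.toEuclideanLin B (Φ t (Matrix.toEuclideanLin C x))

/-- The `k`-algebraic Riccati inequality with gain factor `c`:
`P^{(k)} A^{[k]} + (A^{[k]})ᵀ P^{(k)} + η P^{(k)}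
  + Q^{(k)} (c (Q B Bᵀ Q)^{[k]} + (Q⁻¹ Cᵀ C Q⁻¹)^{[k]}) Q^{(k)} ⪯ 0`. -/
def KARI {n m p : ℕ} (k : ℕ) (A : Matrix (Fin n) (Fin n) ℝ) (B : Matrix (Fin n) (Fin m) ℝ)
    (C : Matrix (Fin p) (Fin n) ℝ) (P Q : Matrix (Fin n) (Fin n) ℝ) (η c : ℝ) : Prop :=
  (-(mulCompound k P * addCompound k A + (addCompound k A)ᵀ * mulCompound k P
      + η • mulCompound k P
      + mulCompound k Q *
          (c • addCompound k (Q * B * Bᵀ * Q) + addCompound k (Q⁻¹ * Cᵀ * C * Q⁻¹)) *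
        mulCompound k Q)).PosSemidef

end Lurie

end

/-! The Jacobian of the vector field is `A - B * K * C`, where `K` is the Jacobian of `Φ` and has
largest singular value at most `q`. Completing the square shows that `q² QBBᵀQ + Q⁻¹CᵀCQ⁻¹ + QBKCQ⁻¹
+ (QBKCQ⁻¹)ᵀ` is positive semidefinite. The additive compound is linear, preserves semidefiniteness
(its eigenvalues on a symmetric matrix are `k`-fold sums of eigenvalues) and turns conjugation by
`Q` into conjugation by `H = Q^{(k)}`. Adding the result to the Riccati inequality leaves the
Lyapunov inequality `2⟨Hz, H J^{[k]} z⟩ ≤ -η₁ |Hz|²`, uniformly in time and state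
(`KARI.two_mul_dotProduct_le`).

Both conclusions follow from it. The bound on the matrix measure is a first-order expansion of `|I +
εT|` with `T = H J^{[k]} H⁻¹`. For contraction, `W` solves the variational equation `Ẇ = J W`, so
`W^{(k)}` solves the linear equation with matrix `J^{[k]}`, and `|H W^{(k)}|` decays.
Differentiability in the parameter is a Grönwall argument (`hasFDerivWithinAt_of_variational`), made
global by the uniform bound on `J`.

The variant `c = q^{2k}` with `q ≥ 1` reduces to `c = q²`, since a larger `c` is a stronger
hypothesis. -/

noncomputable section

namespace Lurie

/-! ### Algebra of the multiplicative and additive compounds. -/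

section Compound

variable {n m p k : ℕ}

/-- Minors of a diagonal matrix. -/
theorem mulCompound_diagonal (d : Fin n → ℝ) :
    mulCompound k (Matrix.diagonal d) = Matrix.diagonal fun κ : Seq k n => ∏ i, d (κ i) := by
  ext κ l
  by_cases h : κ = l
  · subst h
    rw [Matrix.diagonal_apply_eq]
    simp only [mulCompound, Matrix.of_apply]
    rw [Matrix.submatrix_diagonal _ _ κ.injective, Matrix.det_diagonal]
    rfl
  · rw [Matrix.diagonal_apply_ne _ h]
    simp only [mulCompound, Matrix.of_apply]
    -- An increasing sequence is determined by its range, so two different ones of equal length have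
    -- different ranges; the minor then has a zero row.
    have : ∃ i, κ i ∉ Set.range l := by
      by_contra! hc
      apply h
      have hs : Finset.univ.image κ = Finset.univ.image l := by
        apply Finset.eq_of_subset_of_card_le
        · intro a ha
          obtain ⟨i, -, rfl⟩ := Finset.mem_image.1 ha
          obtain ⟨j, hj⟩ := hc i
          exact Finset.mem_image.2 ⟨j, Finset.mem_univ _, hj⟩
        · rw [Finset.card_image_of_injective _ κ.injective,
            Finset.card_image_of_injective _ l.injective]
      have hr : Set.range κ = Set.range l := by
        simpa using congrArg (fun s : Finset (Fin n) => (s : Set (Fin n))) hs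
      exact OrderEmbedding.range_inj.1 hr
    obtain ⟨i, hi⟩ := this
    refine Matrix.det_eq_zero_of_row_eq_zero i fun j => ?_
    rw [Matrix.submatrix_apply, Matrix.diagonal_apply_ne]
    exact fun hij => hi ⟨j, hij.symm⟩

theorem mulCompound_one : mulCompound k (1 : Matrix (Fin n) (Fin n) ℝ) = 1 := by
  rw [← Matrix.diagonal_one, mulCompound_diagonal]
  simp

theorem mulCompound_transpose (A : Matrix (Fin n) (Fin m) ℝ) :
    mulCompound k Aᵀ = (mulCompound k A)ᵀ := by
  ext κ l
  simp only [mulCompound, Matrix.of_apply, Matrix.transpose_apply]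
  rw [← Matrix.det_transpose, Matrix.transpose_submatrix, Matrix.transpose_transpose]

/-- The Cauchy–Binet formula for a `k × n` matrix and `k` vectors. -/
theorem det_mulVec_eq_sum (A : Matrix (Fin k) (Fin n) ℝ) (v : Fin k → Fin n → ℝ) :
    (Matrix.of fun i => A *ᵥ v i).det =
      ∑ κ : Seq k n, (Matrix.of fun i j => v i (κ j)).det * (A.submatrix id κ).det := by
  -- The left side is alternating in `v`, hence a linear functional on the exterior power; expanding
  -- `v₁ ∧ ⋯ ∧ vₖ` in the standard basis, whose coordinates are minors, gives the sum.
  let g : (Fin n → ℝ) [⋀^Fin k]→ₗ[ℝ] ℝ :=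
    Matrix.detRowAlternating.compLinearMap A.mulVecLin
  have hg : ∀ w : Fin k → Fin n → ℝ, g w = (Matrix.of fun i => A *ᵥ w i).det := fun w => rfl
  let b := (Pi.basisFun ℝ (Fin n)).exteriorPower k
  have hsum := b.sum_repr (exteriorPower.ιMulti ℝ k v)
  have h1 := congrArg (exteriorPower.alternatingMapLinearEquiv g) hsum
  rw [exteriorPower.alternatingMapLinearEquiv_apply_ιMulti, hg, map_sum] at h1
  rw [← h1, ← (Set.powersetCard.ofFinEmbEquiv (n := k) (I := Fin n)).sum_comp]
  refine Finset.sum_congr rfl fun κ _ => ?_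
  rw [map_smul, smul_eq_mul, ← Module.Basis.coord_apply]
  congr 1
  · rw [exteriorPower.basis_coord, exteriorPower.ιMultiDual_apply_ιMulti]
    simp
  · rw [exteriorPower.basis_apply, exteriorPower.ιMulti_family,
      exteriorPower.alternatingMapLinearEquiv_apply_ιMulti, hg, ← Matrix.det_transpose]
    congr 1
    ext i j
    simp

/-- The Cauchy–Binet formula: the multiplicative compound is multiplicative. -/
theorem mulCompound_mul (A : Matrix (Fin n) (Fin m) ℝ) (B : Matrix (Fin m) (Fin p) ℝ) :
    mulCompound k (A * B) = mulCompound k A * mulCompound k B := by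
  ext κ l
  rw [Matrix.mul_apply]
  simp only [mulCompound, Matrix.of_apply]
  have h := det_mulVec_eq_sum (A.submatrix κ id) fun i a => B a (l i)
  rw [← Matrix.det_transpose] at h
  refine Eq.trans rfl (h.trans (Finset.sum_congr rfl fun s _ => ?_))
  rw [mul_comm, ← Matrix.det_transpose (B.submatrix s l)]
  rfl

theorem wedgeColumns_mul (A : Matrix (Fin n) (Fin n) ℝ) (X : Matrix (Fin n) (Fin k) ℝ) :
    wedgeColumns (A * X) = mulCompound k A *ᵥ wedgeColumns X := by
  ext κ
  simp only [wedgeColumns, mulCompound_mul]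
  rfl

theorem mulCompound_inv_mul {Q : Matrix (Fin n) (Fin n) ℝ} (hQ : IsUnit Q.det) :
    mulCompound k Q⁻¹ * mulCompound k Q = 1 := by
  rw [← mulCompound_mul, Matrix.nonsing_inv_mul _ hQ, mulCompound_one]

theorem mulCompound_mul_inv {Q : Matrix (Fin n) (Fin n) ℝ} (hQ : IsUnit Q.det) :
    mulCompound k Q * mulCompound k Q⁻¹ = 1 := by
  rw [← mulCompound_mul, Matrix.mul_nonsing_inv _ hQ, mulCompound_one]

theorem differentiable_det {ι : Type*} [Fintype ι] [DecidableEq ι] :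
    Differentiable ℝ fun X : ι → ι → ℝ => (Matrix.of X).det := by
  simp only [Matrix.det_apply, Matrix.of_apply]
  fun_prop

theorem differentiable_mulCompound_apply (κ : Seq k n) (l : Seq k m) :
    Differentiable ℝ fun X : Fin n → Fin m → ℝ => mulCompound k (Matrix.of X) κ l := by
  refine differentiable_det.comp (f := fun (X : Fin n → Fin m → ℝ) i j => X (κ i) (l j)) ?_
  fun_prop

/-- Entrywise, the additive compound is the derivative at `1` of the multiplicative one. -/
theorem hasDerivAt_mulCompound_one_add (A : Matrix (Fin n) (Fin n) ℝ) (κ l : Seq k n) :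
    HasDerivAt (fun ε : ℝ => mulCompound k (1 + ε • A) κ l) (addCompound k A κ l) 0 := by
  refine DifferentiableAt.hasDerivAt ?_
  refine (differentiable_mulCompound_apply κ l).differentiableAt.comp (0 : ℝ)
    (f := fun (ε : ℝ) i j => (1 : Matrix (Fin n) (Fin n) ℝ) i j + ε * A i j) ?_
  fun_prop

/-- By the chain rule; as the value of a Fréchet derivative, each entry is visibly linear in `A`. -/
theorem addCompound_apply_eq_fderiv (A : Matrix (Fin n) (Fin n) ℝ) (κ l : Seq k n) :
    addCompound k A κ l =
      fderiv ℝ (fun X : Fin n → Fin n → ℝ => mulCompound k (Matrix.of X) κ l)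
        (fun i j => (1 : Matrix (Fin n) (Fin n) ℝ) i j) (fun i j => A i j) := by
  refine (hasDerivAt_mulCompound_one_add A κ l).unique ?_
  have hd : HasDerivAt (fun (ε : ℝ) (i j : Fin n) => (1 : Matrix (Fin n) (Fin n) ℝ) i j + ε * A i j)
      (fun i j => A i j) 0 := by
    refine hasDerivAt_pi.2 fun i => hasDerivAt_pi.2 fun j => ?_
    simpa using ((hasDerivAt_id (0 : ℝ)).mul_const (A i j)).const_add
      ((1 : Matrix (Fin n) (Fin n) ℝ) i j)
  have hf := (differentiable_mulCompound_apply (k := k) κ l).differentiableAt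
    (x := fun i j => (1 : Matrix (Fin n) (Fin n) ℝ) i j + (0 : ℝ) * A i j) |>.hasFDerivAt
  have := hf.comp_hasDerivAt (0 : ℝ) hd
  simp only [zero_mul, add_zero] at this
  exact this

theorem addCompound_add (A B : Matrix (Fin n) (Fin n) ℝ) :
    addCompound k (A + B) = addCompound k A + addCompound k B := by
  ext κ l
  simp only [addCompound_apply_eq_fderiv, Matrix.add_apply]
  exact map_add _ (fun i j => A i j) (fun i j => B i j)

theorem addCompound_smul (c : ℝ) (A : Matrix (Fin n) (Fin n) ℝ) :
    addCompound k (c • A) = c • addCompound k A := by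
  ext κ l
  simp only [addCompound_apply_eq_fderiv, Matrix.smul_apply]
  exact map_smul _ c (fun i j => A i j)

theorem addCompound_neg (A : Matrix (Fin n) (Fin n) ℝ) :
    addCompound k (-A) = -addCompound k A := by
  simpa using addCompound_smul (k := k) (-1) A

theorem addCompound_sub (A B : Matrix (Fin n) (Fin n) ℝ) :
    addCompound k (A - B) = addCompound k A - addCompound k B := by
  rw [sub_eq_add_neg, addCompound_add, addCompound_neg, sub_eq_add_neg]

theorem addCompound_transpose (A : Matrix (Fin n) (Fin n) ℝ) :
    addCompound k Aᵀ = (addCompound k A)ᵀ := by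
  ext κ l
  simp only [addCompound, Matrix.of_apply, Matrix.transpose_apply]
  congr 1
  ext ε
  rw [← Matrix.transpose_apply (mulCompound k (1 + ε • A)), ← mulCompound_transpose]
  simp

/-- The additive compound of a conjugated matrix. -/
theorem addCompound_conj {T S : Matrix (Fin n) (Fin n) ℝ} (h : T * S = 1)
    (A : Matrix (Fin n) (Fin n) ℝ) :
    addCompound k (T * A * S) = mulCompound k T * addCompound k A * mulCompound k S := by
  ext κ l
  refine (hasDerivAt_mulCompound_one_add _ κ l).unique ?_
  have heq : ∀ ε : ℝ, mulCompound k (1 + ε • (T * A * S)) κ l =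
      ∑ b, (∑ a, mulCompound k T κ a * mulCompound k (1 + ε • A) a b) * mulCompound k S b l := by
    intro ε
    -- Cauchy–Binet applied to this factorization can be differentiated entrywise.
    have : 1 + ε • (T * A * S) = T * (1 + ε • A) * S := by
      rw [mul_add, add_mul, mul_one, h]
      simp
    rw [this, mulCompound_mul, mulCompound_mul]
    simp only [Matrix.mul_apply]
  simp only [heq, Matrix.mul_apply]
  exact HasDerivAt.fun_sum fun b _ => (HasDerivAt.fun_sum fun a _ =>
    (hasDerivAt_mulCompound_one_add A a b).const_mul _).mul_const _

theorem addCompound_diagonal (d : Fin n → ℝ) :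
    addCompound k (Matrix.diagonal d) = Matrix.diagonal fun κ : Seq k n => ∑ i, d (κ i) := by
  ext κ l
  refine (hasDerivAt_mulCompound_one_add _ κ l).unique ?_
  have heq : ∀ ε : ℝ, mulCompound k (1 + ε • Matrix.diagonal d) κ l =
      Matrix.diagonal (fun κ : Seq k n => ∏ i, (1 + ε * d (κ i))) κ l := by
    intro ε
    rw [← mulCompound_diagonal fun i => 1 + ε * d i, ← Matrix.diagonal_one,
      ← Matrix.diagonal_smul, Matrix.diagonal_add]
    rfl
  simp only [heq]
  by_cases h : κ = l
  · subst h
    simp only [Matrix.diagonal_apply_eq]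
    have := HasDerivAt.fun_finsetProd (u := Finset.univ) (x := (0 : ℝ))
      (f := fun (i : Fin k) (ε : ℝ) => 1 + ε * d (κ i)) (f' := fun i => d (κ i))
      fun i _ => by simpa using ((hasDerivAt_id (0 : ℝ)).mul_const (d (κ i))).const_add 1
    simpa using this
  · simp only [Matrix.diagonal_apply_ne _ h]
    exact hasDerivAt_const _ _

/-- The additive compound preserves positive semidefiniteness. -/
theorem posSemidef_addCompound {X : Matrix (Fin n) (Fin n) ℝ} (hX : X.PosSemidef) :
    (addCompound k X).PosSemidef := by
  let U : Matrix (Fin n) (Fin n) ℝ := hX.1.eigenvectorUnitary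
  have hU : U * Uᵀ = 1 := by
    have := Unitary.coe_mul_star_self hX.1.eigenvectorUnitary
    rwa [Unitary.coe_star, Matrix.star_eq_conjTranspose,
      Matrix.conjTranspose_eq_transpose_of_trivial] at this
  have hs : X = U * Matrix.diagonal hX.1.eigenvalues * Uᵀ := by
    conv_lhs => rw [hX.1.spectral_theorem]
    rw [Unitary.conjStarAlgAut_apply, Matrix.star_eq_conjTranspose,
      Matrix.conjTranspose_eq_transpose_of_trivial]
    rfl
  rw [hs, addCompound_conj hU, mulCompound_transpose, addCompound_diagonal,
    ← Matrix.conjTranspose_eq_transpose_of_trivial]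
  refine Matrix.PosSemidef.mul_mul_conjTranspose_same ?_ _
  exact Matrix.PosSemidef.diagonal fun κ => Finset.sum_nonneg fun i _ => hX.eigenvalues_nonneg _

end Compound

/-! ### The largest singular value as an operator bound. -/

section SingularValue

variable {n m : ℕ}

theorem sigmaOne_nonneg (A : Matrix (Fin m) (Fin n) ℝ) : 0 ≤ sigmaOne A :=
  LinearMap.singularValues_nonneg _ _

/-- The largest singular value bounds the operator norm. -/
theorem norm_apply_le_singularValues_zero {E F : Type*} [NormedAddCommGroup E]
    [InnerProductSpace ℝ E] [FiniteDimensional ℝ E] [NormedAddCommGroup F]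
    [InnerProductSpace ℝ F] [FiniteDimensional ℝ F] (T : E →ₗ[ℝ] F) (z : E) :
    ‖T z‖ ≤ T.singularValues 0 * ‖z‖ := by
  have hS := T.isSymmetric_adjoint_comp_self
  let b := hS.eigenvectorBasis rfl
  -- Expansion in an eigenbasis of `T* T`, whose eigenvalues are the squared singular values.
  have h1 : ‖T z‖ ^ 2 = ∑ i, hS.eigenvalues rfl i * (inner ℝ (b i) z) ^ 2 := by
    rw [← real_inner_self_eq_norm_sq, ← LinearMap.adjoint_inner_right, ← LinearMap.comp_apply,
      ← b.sum_inner_mul_inner]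
    refine Finset.sum_congr rfl fun i _ => ?_
    rw [← hS, hS.apply_eigenvectorBasis, inner_smul_left, real_inner_comm]
    simp only [RCLike.ofReal_real_eq_id, id_eq, conj_trivial]
    ring
  have h2 : ‖z‖ ^ 2 = ∑ i, (inner ℝ (b i) z) ^ 2 := by
    rw [← real_inner_self_eq_norm_sq, ← b.sum_inner_mul_inner]
    refine Finset.sum_congr rfl fun i _ => ?_
    rw [real_inner_comm, sq]
  have h3 : ‖T z‖ ^ 2 ≤ (T.singularValues 0 * ‖z‖) ^ 2 := by
    rw [mul_pow, h1, h2, Finset.mul_sum]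
    refine Finset.sum_le_sum fun i _ => mul_le_mul_of_nonneg_right ?_ (sq_nonneg _)
    rw [← T.sq_singularValues_fin rfl]
    exact pow_le_pow_left₀ (T.singularValues_nonneg _) (T.singularValues_antitone (Nat.zero_le _)) 2
  exact le_of_sq_le_sq h3 (mul_nonneg (T.singularValues_nonneg _) (norm_nonneg _))

theorem norm_toEuclideanLin_apply_le {A : Matrix (Fin m) (Fin n) ℝ} {q : ℝ} (hA : sigmaOne A ≤ q)
    (z : Vec n) : ‖Matrix.toEuclideanLin A z‖ ≤ q * ‖z‖ :=
  (norm_apply_le_singularValues_zero _ z).trans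
    (mul_le_mul_of_nonneg_right hA (norm_nonneg _))

theorem dotProduct_self_eq_norm_sq {ι : Type*} [Fintype ι] (z : ι → ℝ) :
    z ⬝ᵥ z = ‖WithLp.toLp 2 z‖ ^ 2 := by
  rw [EuclideanSpace.norm_sq_eq]
  simp [dotProduct, sq]

/-- A bound on the largest singular value, as a matrix inequality. -/
theorem posSemidef_sq_smul_one_sub {A : Matrix (Fin m) (Fin n) ℝ} {q : ℝ} (hA : sigmaOne A ≤ q) :
    (q ^ 2 • (1 : Matrix (Fin m) (Fin m) ℝ) - A * Aᵀ).PosSemidef := by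
  have hq : 0 ≤ q := (sigmaOne_nonneg A).trans hA
  refine Matrix.posSemidef_iff_dotProduct_mulVec.2 ⟨?_, fun z => ?_⟩
  · simp [Matrix.IsHermitian, Matrix.conjTranspose_eq_transpose_of_trivial]
  have h1 : z ⬝ᵥ (A * Aᵀ) *ᵥ z = (Aᵀ *ᵥ z) ⬝ᵥ (Aᵀ *ᵥ z) := by
    rw [← Matrix.mulVec_mulVec, Matrix.dotProduct_mulVec, Matrix.mulVec_transpose]
  have h2 : (Aᵀ *ᵥ z) ⬝ᵥ (Aᵀ *ᵥ z) ≤ q ^ 2 * (z ⬝ᵥ z) := by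
    set w := Aᵀ *ᵥ z with hw
    have h3 : w ⬝ᵥ w = inner ℝ (WithLp.toLp 2 z) (Matrix.toEuclideanLin A (WithLp.toLp 2 w)) := by
      rw [← h1, ← Matrix.mulVec_mulVec, ← hw]
      simp [EuclideanSpace.inner_eq_star_dotProduct, dotProduct_comm]
    -- `|w|² = ⟨z, A w⟩ ≤ q |z| |w|`; cancelling `|w|` bounds `Aᵀ` without comparing the singular
    -- values of `A` and `Aᵀ`.
    have h4 : w ⬝ᵥ w ≤ ‖WithLp.toLp 2 z‖ * (q * ‖WithLp.toLp 2 w‖) := by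
      rw [h3]
      exact (real_inner_le_norm _ _).trans
        (mul_le_mul_of_nonneg_left (norm_toEuclideanLin_apply_le hA _) (norm_nonneg _))
    rw [dotProduct_self_eq_norm_sq] at h4 ⊢
    rw [dotProduct_self_eq_norm_sq, ← mul_pow]
    refine pow_le_pow_left₀ (norm_nonneg _) ?_ 2
    by_contra! hlt
    have : 0 < ‖WithLp.toLp 2 w‖ := lt_of_le_of_lt (by positivity) hlt
    nlinarith
  simp only [star_trivial, Matrix.sub_mulVec, Matrix.smul_mulVec, Matrix.one_mulVec,
    dotProduct_sub, dotProduct_smul, smul_eq_mul, h1]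
  linarith

end SingularValue

/-! ### From the Riccati inequality to a Lyapunov inequality. -/

section Lyapunov

variable {n m p k : ℕ}

/-- The two inequalities differ by `(c - d) Q^{(k)} (QBBᵀQ)^{[k]} Q^{(k)}`, which is positive
semidefinite. -/
theorem KARI.mono {A : Matrix (Fin n) (Fin n) ℝ} {B : Matrix (Fin n) (Fin m) ℝ}
    {C : Matrix (Fin p) (Fin n) ℝ} {P Q : Matrix (Fin n) (Fin n) ℝ} {η c d : ℝ}
    (hQ : Q.PosDef) (hdc : d ≤ c) (h : KARI k A B C P Q η c) : KARI k A B C P Q η d := by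
  have hQt : Qᵀ = Q := by
    simpa [Matrix.IsHermitian, Matrix.conjTranspose_eq_transpose_of_trivial] using hQ.1
  have hU : (addCompound k (Q * B * Bᵀ * Q)).PosSemidef := by
    apply posSemidef_addCompound
    have := Matrix.posSemidef_self_mul_conjTranspose (Q * B)
    rwa [Matrix.conjTranspose_eq_transpose_of_trivial, Matrix.transpose_mul, hQt,
      ← Matrix.mul_assoc] at this
  have h2 := (hU.smul (sub_nonneg.2 hdc)).mul_mul_conjTranspose_same (mulCompound k Q)
  rw [Matrix.conjTranspose_eq_transpose_of_trivial, ← mulCompound_transpose, hQt] at h2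
  have h3 := Matrix.PosSemidef.add h h2
  unfold KARI
  convert h3 using 1
  simp only [sub_smul, mul_add, add_mul, mul_sub, sub_mul]
  abel

/-- The Lyapunov inequality for the closed loop: the Riccati inequality absorbs every feedback
matrix `K` with largest singular value at most `q`. -/
theorem KARI.posSemidef_closedLoop {A : Matrix (Fin n) (Fin n) ℝ} {B : Matrix (Fin n) (Fin m) ℝ}
    {C : Matrix (Fin p) (Fin n) ℝ} {Q : Matrix (Fin n) (Fin n) ℝ} {η q : ℝ}
    (hQ : Q.PosDef) (h : KARI k A B C (Q * Q) Q η (q ^ 2)) {K : Matrix (Fin m) (Fin p) ℝ}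
    (hK : sigmaOne K ≤ q) :
    (-(mulCompound k (Q * Q) * addCompound k (A - B * K * C) +
      (addCompound k (A - B * K * C))ᵀ * mulCompound k (Q * Q) +
      η • mulCompound k (Q * Q))).PosSemidef := by
  have hQt : Qᵀ = Q := by
    simpa [Matrix.IsHermitian, Matrix.conjTranspose_eq_transpose_of_trivial] using hQ.1
  have hdet : IsUnit Q.det := (Matrix.isUnit_iff_isUnit_det _).1 hQ.isUnit
  have hQi : Q⁻¹ᵀ = Q⁻¹ := by rw [Matrix.transpose_nonsing_inv, hQt]
  -- Completing the square: the matrix equals `QB (q² I - KKᵀ) (QB)ᵀ + (QBK + Q⁻¹Cᵀ)(QBK + Q⁻¹Cᵀ)ᵀ`.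
  have hX : (q ^ 2 • (Q * B * Bᵀ * Q) + Q⁻¹ * Cᵀ * C * Q⁻¹ + Q * (B * K * C) * Q⁻¹ +
      (Q * (B * K * C) * Q⁻¹)ᵀ).PosSemidef := by
    have h1 := (posSemidef_sq_smul_one_sub hK).mul_mul_conjTranspose_same (Q * B)
    have h2 := Matrix.posSemidef_self_mul_conjTranspose (Q * B * K + Q⁻¹ * Cᵀ)
    have h3 := h1.add h2
    convert h3 using 1
    simp only [Matrix.conjTranspose_eq_transpose_of_trivial, Matrix.transpose_mul,
      Matrix.transpose_add, Matrix.transpose_transpose, hQt, hQi,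
      Matrix.mul_add, Matrix.add_mul, Matrix.mul_smul, Matrix.smul_mul, Matrix.mul_one,
      Matrix.mul_sub, Matrix.sub_mul, Matrix.mul_assoc]
    abel
  have hXk := (posSemidef_addCompound (k := k) hX).mul_mul_conjTranspose_same (mulCompound k Q)
  rw [Matrix.conjTranspose_eq_transpose_of_trivial, ← mulCompound_transpose, hQt,
    addCompound_add, addCompound_add, addCompound_add, addCompound_smul, addCompound_transpose,
    addCompound_conj (Matrix.mul_nonsing_inv _ hdet)] at hXk
  have h3 := Matrix.PosSemidef.add h hXk
  have hi := mulCompound_inv_mul (k := k) hdet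
  have hi' : mulCompound k Q * (mulCompound k Q⁻¹)ᵀ = 1 := by
    rw [← mulCompound_transpose, hQi, mulCompound_mul_inv hdet]
  have hHt : (mulCompound k Q)ᵀ = mulCompound k Q := by rw [← mulCompound_transpose, hQt]
  have e1 : mulCompound k Q * (mulCompound k Q * addCompound k (B * K * C) * mulCompound k Q⁻¹) *
      mulCompound k Q = mulCompound k (Q * Q) * addCompound k (B * K * C) := by
    rw [mulCompound_mul]
    simp only [Matrix.mul_assoc, hi, Matrix.mul_one]
  have e2 : mulCompound k Q * (mulCompound k Q * addCompound k (B * K * C) * mulCompound k Q⁻¹)ᵀ *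
      mulCompound k Q = (addCompound k (B * K * C))ᵀ * mulCompound k (Q * Q) := by
    rw [mulCompound_mul]
    simp only [Matrix.transpose_mul, hHt]
    simp only [← Matrix.mul_assoc, hi', Matrix.one_mul]
  convert h3 using 1
  rw [Matrix.mul_add _ _ (mulCompound k Q * addCompound k (B * K * C) * mulCompound k Q⁻¹)ᵀ,
    Matrix.add_mul, Matrix.mul_add _ _ (mulCompound k Q * addCompound k (B * K * C) *
      mulCompound k Q⁻¹), Matrix.add_mul, e1, e2, addCompound_sub, Matrix.transpose_sub,
    Matrix.mul_sub, Matrix.sub_mul]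
  abel

/-- The Lyapunov inequality for the closed loop, in terms of the quadratic form. -/
theorem KARI.two_mul_dotProduct_le {A : Matrix (Fin n) (Fin n) ℝ} {B : Matrix (Fin n) (Fin m) ℝ}
    {C : Matrix (Fin p) (Fin n) ℝ} {Q : Matrix (Fin n) (Fin n) ℝ} {η q : ℝ}
    (hQ : Q.PosDef) (h : KARI k A B C (Q * Q) Q η (q ^ 2)) {K : Matrix (Fin m) (Fin p) ℝ}
    (hK : sigmaOne K ≤ q) (z : Seq k n → ℝ) :
    2 * ((mulCompound k Q *ᵥ z) ⬝ᵥ (mulCompound k Q *ᵥ addCompound k (A - B * K * C) *ᵥ z)) ≤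
      -η * ((mulCompound k Q *ᵥ z) ⬝ᵥ (mulCompound k Q *ᵥ z)) := by
  have hQt : Qᵀ = Q := by
    simpa [Matrix.IsHermitian, Matrix.conjTranspose_eq_transpose_of_trivial] using hQ.1
  have hHt : (mulCompound k Q)ᵀ = mulCompound k Q := by rw [← mulCompound_transpose, hQt]
  have key : ∀ u v : Seq k n → ℝ, (mulCompound k Q *ᵥ u) ⬝ᵥ (mulCompound k Q *ᵥ v) =
      u ⬝ᵥ (mulCompound k (Q * Q) *ᵥ v) := by
    intro u v
    rw [mulCompound_mul, ← Matrix.mulVec_mulVec, Matrix.dotProduct_mulVec u,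
      ← Matrix.mulVec_transpose, hHt]
  have h1 := (Matrix.posSemidef_iff_dotProduct_mulVec.1 (h.posSemidef_closedLoop hQ hK)).2 z
  simp only [star_trivial, Matrix.neg_mulVec, Matrix.add_mulVec, Matrix.smul_mulVec,
    dotProduct_neg, dotProduct_add, dotProduct_smul, smul_eq_mul, ← Matrix.mulVec_mulVec] at h1
  have h2 : z ⬝ᵥ (addCompound k (A - B * K * C))ᵀ *ᵥ (mulCompound k (Q * Q) *ᵥ z) =
      (mulCompound k Q *ᵥ z) ⬝ᵥ (mulCompound k Q *ᵥ addCompound k (A - B * K * C) *ᵥ z) := by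
    rw [dotProduct_comm (mulCompound k Q *ᵥ z), key, Matrix.dotProduct_mulVec z,
      Matrix.vecMul_transpose]
  rw [h2, ← key, ← key] at h1
  linarith

end Lyapunov

/-! ### Logarithmic norms. -/

section MatrixMeasure

/-- The logarithmic norm exists in every normed algebra: the norm is convex along lines. -/
theorem exists_tendsto_norm_one_add_smul {R : Type*} [NormedRing R] [NormedAlgebra ℝ R]
    [NormOneClass R] (T : R) :
    ∃ μ : ℝ, Tendsto (fun ε : ℝ => (‖1 + ε • T‖ - 1) / ε) (𝓝[>] 0) (𝓝 μ) := by
  have hc : ConvexOn ℝ univ fun ε : ℝ => ‖1 + ε • T‖ := by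
    refine ⟨convex_univ, fun x _ y _ a b ha hb hab => ?_⟩
    have : 1 + (a • x + b • y) • T = a • (1 + x • T) + b • (1 + y • T) := by
      have h1 : (1 : R) = (a + b) • (1 : R) := by rw [hab, one_smul]
      conv_lhs => rw [h1]
      module
    simp only [this]
    refine (norm_add_le _ _).trans ?_
    rw [norm_smul, norm_smul, Real.norm_of_nonneg ha, Real.norm_of_nonneg hb]
    rfl
  -- The difference quotients of a convex function have a right limit.
  have hd := (hc.differentiableWithinAt_Ioi_of_mem_interior
    (x := 0) (by simp)).hasDerivWithinAt
  refine ⟨_, ((hasDerivWithinAt_iff_tendsto_slope' self_notMem_Ioi).1 hd).congr fun ε => ?_⟩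
  simp [slope_def_field]

/-- A dissipativity estimate bounds the logarithmic norm. -/
theorem le_of_tendsto_norm_one_add_smul {E : Type*} [NormedAddCommGroup E]
    [InnerProductSpace ℝ E] {T : E →L[ℝ] E} {η μ : ℝ}
    (hT : ∀ z, 2 * inner ℝ z (T z) ≤ -η * ‖z‖ ^ 2)
    (hμ : Tendsto (fun ε : ℝ => (‖1 + ε • T‖ - 1) / ε) (𝓝[>] 0) (𝓝 μ)) : μ ≤ -(η / 2) := by
  have hlim : Tendsto (fun ε : ℝ => -(η / 2) + ε * ‖T‖ ^ 2 / 2) (𝓝[>] 0) (𝓝 (-(η / 2))) := by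
    have : ContinuousAt (fun ε : ℝ => -(η / 2) + ε * ‖T‖ ^ 2 / 2) 0 := by fun_prop
    have h := this.tendsto.mono_left (nhdsWithin_le_nhds (s := Ioi 0))
    simpa using h
  refine le_of_tendsto_of_tendsto hμ hlim ?_
  have hpos : ∀ᶠ ε : ℝ in 𝓝[>] 0, 0 ≤ 1 - ε * (η / 2) := by
    have : ContinuousAt (fun ε : ℝ => 1 - ε * (η / 2)) 0 := by fun_prop
    have h := this.tendsto.mono_left (nhdsWithin_le_nhds (s := Ioi 0))
    simp only [zero_mul, sub_zero] at h
    exact h.eventually_const_le one_pos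
  filter_upwards [hpos, self_mem_nhdsWithin] with ε h1 (hε : 0 < ε)
  have hb : 0 ≤ 1 - ε * (η / 2) + ε ^ 2 * ‖T‖ ^ 2 / 2 := by positivity
  -- Expanding the square gives `|z + εTz|² ≤ (1 - εη + ε²‖T‖²) |z|²`; the bound is then `√(1 + s) ≤
  -- 1 + s/2`.
  have hle : ‖1 + ε • T‖ ≤ 1 - ε * (η / 2) + ε ^ 2 * ‖T‖ ^ 2 / 2 := by
    refine ContinuousLinearMap.opNorm_le_bound _ hb fun z => ?_
    refine le_of_sq_le_sq ?_ (mul_nonneg hb (norm_nonneg z))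
    have hz : (1 + ε • T) z = z + ε • T z := rfl
    have hTz : ‖T z‖ ^ 2 ≤ ‖T‖ ^ 2 * ‖z‖ ^ 2 := by
      rw [← mul_pow]
      exact pow_le_pow_left₀ (norm_nonneg _) (T.le_opNorm z) 2
    rw [hz, norm_add_sq_real, inner_smul_right, norm_smul, mul_pow, mul_pow,
      Real.norm_of_nonneg hε.le]
    have h2 := mul_le_mul_of_nonneg_left (hT z) hε.le
    have h3 := mul_le_mul_of_nonneg_left hTz (sq_nonneg ε)
    have h4 : 1 - ε * η + ε ^ 2 * ‖T‖ ^ 2 ≤ (1 - ε * (η / 2) + ε ^ 2 * ‖T‖ ^ 2 / 2) ^ 2 := by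
      nlinarith [sq_nonneg (1 - ε * (η / 2) + ε ^ 2 * ‖T‖ ^ 2 / 2 - 1)]
    have h5 := mul_le_mul_of_nonneg_right h4 (sq_nonneg ‖z‖)
    linarith
  rw [div_le_iff₀ hε]
  linarith [hle, show (-(η / 2) + ε * ‖T‖ ^ 2 / 2) * ε = -(ε * (η / 2)) + ε ^ 2 * ‖T‖ ^ 2 / 2 by
    ring]

variable {ι : Type} [Fintype ι] [DecidableEq ι]

/-- The substitution `w = H z` carries the scaled unit sphere onto the Euclidean one. -/
theorem inducedNorm_scaledNorm {H G : Matrix ι ι ℝ} (hHG : H * G = 1) (A : Matrix ι ι ℝ) :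
    inducedNorm (scaledNorm H) A = ‖Matrix.toEuclideanCLM (𝕜 := ℝ) (H * A * G)‖ := by
  have hGH : G * H = 1 := mul_eq_one_comm.1 hHG
  rw [inducedNorm, ← ContinuousLinearMap.sSup_sphere_eq_norm]
  congr 1
  ext a
  simp only [mem_ofPred_eq, mem_image, mem_sphere_iff_norm, sub_zero, scaledNorm]
  constructor
  · rintro ⟨z, hz, rfl⟩
    refine ⟨WithLp.toLp 2 (H *ᵥ z), hz, ?_⟩
    rw [Matrix.toEuclideanCLM_toLp]
    simp only [Matrix.mulVec_mulVec, Matrix.mul_assoc, hGH, Matrix.mul_one]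
  · rintro ⟨w, hw, rfl⟩
    refine ⟨G *ᵥ w.ofLp, ?_, ?_⟩
    · rw [Matrix.mulVec_mulVec, hHG, Matrix.one_mulVec]
      exact hw
    · simp only [Matrix.mulVec_mulVec, ← Matrix.mul_assoc]
      rfl

/-- A Lyapunov inequality bounds the matrix measure of a scaled Euclidean norm. -/
theorem exists_isMatrixMeasure_le [Nonempty ι] {H G : Matrix ι ι ℝ} (hHG : H * G = 1)
    {M : Matrix ι ι ℝ} {η : ℝ}
    (hM : ∀ z, 2 * ((H *ᵥ z) ⬝ᵥ (H *ᵥ M *ᵥ z)) ≤ -η * ((H *ᵥ z) ⬝ᵥ (H *ᵥ z))) :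
    ∃ μ, IsMatrixMeasure (scaledNorm H) M μ ∧ μ ≤ -(η / 2) := by
  have hGH : G * H = 1 := mul_eq_one_comm.1 hHG
  set T := Matrix.toEuclideanCLM (𝕜 := ℝ) (H * M * G) with hT
  obtain ⟨μ, hμ⟩ := exists_tendsto_norm_one_add_smul T
  refine ⟨μ, hμ.congr fun ε => ?_, le_of_tendsto_norm_one_add_smul (fun z => ?_) hμ⟩
  · rw [inducedNorm_scaledNorm hHG, Matrix.mul_add, Matrix.add_mul, Matrix.mul_one, hHG,
      Matrix.mul_smul, Matrix.smul_mul, map_add, map_one, map_smul]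
  · have h := hM (G *ᵥ z.ofLp)
    simp only [Matrix.mulVec_mulVec, hHG, Matrix.one_mulVec] at h
    rw [hT, Matrix.inner_toEuclideanCLM, ← real_inner_self_eq_norm_sq,
      EuclideanSpace.inner_eq_star_dotProduct]
    simpa [Matrix.mul_assoc] using h

end MatrixMeasure

/-! ### Linear equations and differentiable dependence on parameters. -/

section Flow

variable {E F : Type*} [NormedAddCommGroup E] [NormedSpace ℝ E] [NormedAddCommGroup F]
  [NormedSpace ℝ F]

/-- Short-time existence for linear differential equations, on an interval whose length depends
only on the bound of the coefficients. -/
theorem exists_linear_solution_of_short [CompleteSpace E] {T : ℝ → E →L[ℝ] E} {a b L : ℝ}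
    (hab : a ≤ b) (hT : ContinuousOn T (Icc a b)) (hL : ∀ t ∈ Icc a b, ‖T t‖ ≤ L)
    (hshort : 2 * L * (b - a) ≤ 1) (w₀ : E) :
    ∃ w : ℝ → E, w a = w₀ ∧ ∀ t ∈ Icc a b, HasDerivWithinAt w (T t (w t)) (Icc a b) t := by
  have ha : a ∈ Icc a b := left_mem_Icc.2 hab
  have hL0 : 0 ≤ L := (norm_nonneg _).trans (hL a ha)
  -- On the ball of radius `|w₀|` about `w₀` the field is at most `2L|w₀|`, so the admissible time
  -- `1/(2L)` does not depend on `w₀`.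
  have hPL : IsPicardLindelof (fun t w => T t w) (⟨a, ha⟩ : Icc a b) w₀ ‖w₀‖₊ 0
      (2 * L.toNNReal * ‖w₀‖₊) L.toNNReal := by
    refine ⟨fun t ht => ?_, fun w _ => ?_, fun t ht w hw => ?_, ?_⟩
    · refine ((T t).lipschitz.weaken ?_).lipschitzOnWith
      rw [← NNReal.coe_le_coe, Real.coe_toNNReal _ hL0]
      exact hL t ht
    · exact hT.clm_apply continuousOn_const
    · have hw' : ‖w‖ ≤ 2 * ‖w₀‖ := by
        have h1 : ‖w - w₀‖ ≤ ‖w₀‖ := by simpa [dist_eq_norm] using hw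
        have h2 := norm_add_le (w - w₀) w₀
        rw [sub_add_cancel] at h2
        linarith
      refine ((T t).le_opNorm w).trans ?_
      simp only [NNReal.coe_mul, NNReal.coe_ofNat, Real.coe_toNNReal _ hL0, coe_nnnorm]
      calc ‖T t‖ * ‖w‖ ≤ L * (2 * ‖w₀‖) := by
            gcongr
            exact hL t ht
        _ = 2 * L * ‖w₀‖ := by ring
    · simp only [NNReal.coe_mul, NNReal.coe_ofNat, Real.coe_toNNReal _ hL0, coe_nnnorm, sub_self,
        NNReal.coe_zero, sub_zero]
      rw [max_eq_left (sub_nonneg.2 hab)]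
      have := mul_le_mul_of_nonneg_right hshort (norm_nonneg w₀)
      linarith
  exact hPL.exists_eq_forall_mem_Icc_hasDerivWithinAt₀

theorem hasDerivWithinAt_Ici_of_Icc {g : ℝ → E} {g' : E} {a b t : ℝ} (ht : t ∈ Ico a b)
    (h : HasDerivWithinAt g g' (Icc a b) t) : HasDerivWithinAt g g' (Ici t) t :=
  h.mono_of_mem_nhdsWithin (Icc_mem_nhdsGE_of_mem ht)

/-- Homogeneity extracts the small factor `c / (G + 1) * ‖s - r‖` from the error estimate below. -/
theorem gronwallBound_mul (c δ K ε x : ℝ) :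
    gronwallBound (c * δ) K (c * ε) x = c * gronwallBound δ K ε x := by
  unfold gronwallBound
  split_ifs <;> ring

theorem gronwallBound_nonneg {δ K ε x : ℝ} (hδ : 0 ≤ δ) (hε : 0 ≤ ε) (hK : 0 ≤ K) (hx : 0 ≤ x) :
    0 ≤ gronwallBound δ K ε x := by
  have := gronwallBound_mono hδ hε hK hx
  rw [gronwallBound_x0] at this
  exact hδ.trans this

/-- Differentiable dependence of trajectories on a parameter, given differentiable dependence at
the initial time and a solution of the variational equation. -/
theorem hasFDerivWithinAt_of_variational [ProperSpace E] {f : ℝ → E → E}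
    {f' : ℝ → E → E →L[ℝ] E} {a b L : ℝ}
    (hf' : ContinuousOn (fun z : ℝ × E => f' z.1 z.2) (Icc a b ×ˢ univ))
    (hd : ∀ t ∈ Icc a b, ∀ y, HasFDerivAt (f t) (f' t y) y)
    (hL : ∀ t ∈ Icc a b, ∀ y, ‖f' t y‖ ≤ L)
    {x : F → ℝ → E} {D : Set F} {r : F} (hr : r ∈ D)
    (hx : ∀ s ∈ D, ∀ t ∈ Icc a b, HasDerivWithinAt (x s) (f t (x s t)) (Icc a b) t)
    {W : ℝ → F →L[ℝ] E}
    (hW : ∀ t ∈ Icc a b, HasDerivWithinAt W ((f' t (x r t)).comp (W t)) (Icc a b) t)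
    (h0 : HasFDerivWithinAt (fun s => x s a) (W a) D r) {t : ℝ} (ht : t ∈ Icc a b) :
    HasFDerivWithinAt (fun s => x s t) (W t) D r := by
  have hab : a ≤ b := ht.1.trans ht.2
  have hL0 : 0 ≤ L := (norm_nonneg _).trans (hL t ht 0)
  have hxc : ∀ s ∈ D, ContinuousOn (x s) (Icc a b) := fun s hs u hu =>
    (hx s hs u hu).continuousWithinAt
  -- Trajectories separate at most exponentially.
  have hsep : ∀ s ∈ D, ∀ u ∈ Icc a b,
      ‖x s u - x r u‖ ≤ ‖x s a - x r a‖ * Real.exp (L * (b - a)) := by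
    intro s hs u hu
    have h1 := norm_le_gronwallBound_of_norm_deriv_right_le (f := fun u => x s u - x r u)
      (f' := fun u => f u (x s u) - f u (x r u)) (δ := ‖x s a - x r a‖) (K := L) (ε := 0)
      (a := a) (b := b) ((hxc s hs).sub (hxc r hr))
      (fun u hu => hasDerivWithinAt_Ici_of_Icc hu
        ((hx s hs u (Ico_subset_Icc_self hu)).sub (hx r hr u (Ico_subset_Icc_self hu))))
      le_rfl
      (fun u hu => by
        rw [add_zero]
        exact convex_univ.norm_image_sub_le_of_norm_hasFDerivWithin_le
          (fun y _ => (hd u (Ico_subset_Icc_self hu) y).hasFDerivWithinAt)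
          (fun y _ => hL u (Ico_subset_Icc_self hu) y) (mem_univ _) (mem_univ _)) u hu
    rw [gronwallBound_ε0] at h1
    refine h1.trans ?_
    gcongr
    exact hu.2
  -- The derivative of the vector field is uniformly continuous along the reference trajectory.
  have hunif : ∀ ε > 0, ∃ δ > 0, ∀ u ∈ Icc a b, ∀ y, ‖y - x r u‖ < δ →
      ‖f' u y - f' u (x r u)‖ ≤ ε := by
    intro ε hε
    -- Recentring at the trajectory makes its unit tube a compact product; hence the `min δ 1`
    -- below.
    have hcont : ContinuousOn (fun z : ℝ × E => f' z.1 (x r z.1 + z.2))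
        (Icc a b ×ˢ Metric.closedBall 0 1) := by
      refine hf'.comp (f := fun z : ℝ × E => (z.1, x r z.1 + z.2)) ?_ fun z hz => ⟨hz.1, mem_univ _⟩
      exact continuousOn_fst.prodMk
        (((hxc r hr).comp continuousOn_fst fun z hz => hz.1).add continuousOn_snd)
    have huc := (isCompact_Icc.prod (isCompact_closedBall (0 : E) 1)).uniformContinuousOn_of_continuous
      hcont
    rw [Metric.uniformContinuousOn_iff] at huc
    obtain ⟨δ, hδ, hu⟩ := huc ε hε
    refine ⟨min δ 1, lt_min hδ one_pos, fun u hu' y hy => ?_⟩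
    have h := hu (u, y - x r u) ⟨hu', by
      simpa using (hy.trans_le (min_le_right _ _)).le⟩ (u, 0) ⟨hu', by simp⟩ (by
      rw [Prod.dist_eq]
      simpa using hy.trans_le (min_le_left _ _))
    rw [dist_eq_norm] at h
    simpa using h.le
  -- `c₁` bounds the growth of separations, `c₂` is a Lipschitz constant at `r` of the initial data,
  -- and `G` is the Grönwall bound of the normalized error. Tolerances `c / (G + 1)` yield the final
  -- `c * G / (G + 1) ≤ c`.
  set c₁ := Real.exp (L * (b - a)) with hc₁
  have hc₁0 : 0 < c₁ := Real.exp_pos _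
  set c₂ := ‖W a‖ + 1 with hc₂
  have hc₂0 : 0 < c₂ := by positivity
  set G := gronwallBound 1 L (c₁ * c₂) (t - a) with hG
  have hG0 : 0 ≤ G := gronwallBound_nonneg zero_le_one (by positivity) hL0 (sub_nonneg.2 ht.1)
  rw [hasFDerivWithinAt_iff_isLittleO, Asymptotics.isLittleO_iff]
  intro c hc
  obtain ⟨δ, hδ, hδ'⟩ := hunif (c / (G + 1)) (by positivity)
  have h0' := h0
  rw [hasFDerivWithinAt_iff_isLittleO] at h0'
  have e1 := (Asymptotics.isLittleO_iff.1 h0') (c := c / (G + 1)) (by positivity)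
  have e2 := (Asymptotics.isLittleO_iff.1 h0') (c := 1) one_pos
  have e3 : ∀ᶠ s in 𝓝[D] r, ‖s - r‖ < δ / (c₁ * c₂) := by
    have : Tendsto (fun s : F => ‖s - r‖) (𝓝[D] r) (𝓝 0) := by
      have h : ContinuousAt (fun s : F => ‖s - r‖) r := by fun_prop
      simpa using h.tendsto.mono_left (nhdsWithin_le_nhds (s := D))
    exact this.eventually_lt_const (by positivity)
  filter_upwards [e1, e2, e3, self_mem_nhdsWithin] with s h1 h2 h3 hs
  have hinit : ‖x s a - x r a‖ ≤ c₂ * ‖s - r‖ := by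
    have h4 := norm_add_le (x s a - x r a - W a (s - r)) (W a (s - r))
    rw [sub_add_cancel] at h4
    have h5 := (W a).le_opNorm (s - r)
    rw [hc₂]
    linarith
  have hdist : ∀ u ∈ Icc a b, ‖x s u - x r u‖ ≤ c₁ * c₂ * ‖s - r‖ := fun u hu => by
    refine (hsep s hs u hu).trans ?_
    calc ‖x s a - x r a‖ * c₁ ≤ c₂ * ‖s - r‖ * c₁ := by gcongr
      _ = c₁ * c₂ * ‖s - r‖ := by ring
  have hclose : ∀ u ∈ Icc a b, ‖x s u - x r u‖ < δ := fun u hu => by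
    refine (hdist u hu).trans_lt ?_
    rwa [lt_div_iff₀' (by positivity)] at h3
  -- The derivative of the error is `f'` applied to the error, plus the Taylor remainder of `f`,
  -- which is small because `f'` barely varies on the `δ`-ball.
  have herr := norm_le_gronwallBound_of_norm_deriv_right_le
    (f := fun u => x s u - x r u - W u (s - r))
    (f' := fun u => f u (x s u) - f u (x r u) - f' u (x r u) (W u (s - r)))
    (δ := c / (G + 1) * ‖s - r‖ * 1) (K := L) (ε := c / (G + 1) * ‖s - r‖ * (c₁ * c₂))
    (a := a) (b := b)
    (((hxc s hs).sub (hxc r hr)).sub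
      (ContinuousOn.clm_apply (fun u hu => (hW u hu).continuousWithinAt) continuousOn_const))
    (fun u hu => by
      have hu' := Ico_subset_Icc_self hu
      refine hasDerivWithinAt_Ici_of_Icc hu (((hx s hs u hu').sub (hx r hr u hu')).sub ?_)
      simpa using (hW u hu').clm_apply (hasDerivWithinAt_const u (Icc a b) (s - r)))
    (by rw [mul_one]; exact h1)
    (fun u hu => by
      have hu' := Ico_subset_Icc_self hu
      have h6 := (convex_ball (x r u) δ).norm_image_sub_le_of_norm_hasFDerivWithin_le'
        (f := f u) (f' := f' u) (φ := f' u (x r u)) (C := c / (G + 1)) (x := x r u) (y := x s u)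
        (fun y _ => (hd u hu' y).hasFDerivWithinAt)
        (fun y hy => hδ' u hu' y (by simpa [dist_eq_norm] using hy))
        (Metric.mem_ball_self hδ) (by simpa [dist_eq_norm] using hclose u hu')
      have h7 : f u (x s u) - f u (x r u) - f' u (x r u) (W u (s - r)) =
          (f u (x s u) - f u (x r u) - f' u (x r u) (x s u - x r u)) +
            f' u (x r u) (x s u - x r u - W u (s - r)) := by
        rw [map_sub (f' u (x r u)) (x s u - x r u)]
        abel
      rw [h7]
      refine (norm_add_le _ _).trans ?_
      have h8 : ‖f' u (x r u) (x s u - x r u - W u (s - r))‖ ≤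
          L * ‖x s u - x r u - W u (s - r)‖ :=
        ((f' u (x r u)).le_opNorm _).trans
          (mul_le_mul_of_nonneg_right (hL u hu' _) (norm_nonneg _))
      have h9 : c / (G + 1) * ‖x s u - x r u‖ ≤ c / (G + 1) * ‖s - r‖ * (c₁ * c₂) := by
        calc c / (G + 1) * ‖x s u - x r u‖ ≤ c / (G + 1) * (c₁ * c₂ * ‖s - r‖) := by
              gcongr
              exact hdist u hu'
          _ = _ := by ring
      linarith) t ht
  rw [gronwallBound_mul, ← hG] at herr
  refine herr.trans ?_
  calc c / (G + 1) * ‖s - r‖ * G = c * (G / (G + 1)) * ‖s - r‖ := by ring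
    _ ≤ c * 1 * ‖s - r‖ := by
        gcongr
        rw [div_le_one (by positivity)]
        linarith
    _ = c * ‖s - r‖ := by ring

end Flow

/-! ### The closed-loop Jacobian and decay of `k`-volumes. -/

section Contraction

variable {n m p k : ℕ}

/-- The matrix of a linear map between Euclidean spaces in the standard bases. -/
def clmMatrix (T : Vec n →L[ℝ] Vec m) : Matrix (Fin m) (Fin n) ℝ :=
  Matrix.of fun i j => T (EuclideanSpace.single j 1) i

/-- The linear map between Euclidean spaces given by a matrix. -/
def matrixCLM (A : Matrix (Fin m) (Fin n) ℝ) : Vec n →L[ℝ] Vec m :=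
  (Matrix.toEuclideanLin A).toContinuousLinearMap

theorem matrixCLM_apply (A : Matrix (Fin m) (Fin n) ℝ) (v : Vec n) :
    matrixCLM A v = Matrix.toEuclideanLin A v := rfl

theorem clmMatrix_matrixCLM (A : Matrix (Fin m) (Fin n) ℝ) : clmMatrix (matrixCLM A) = A := by
  ext i j
  simp [clmMatrix, matrixCLM_apply, Matrix.toLpLin_apply]

theorem matrixCLM_clmMatrix (T : Vec n →L[ℝ] Vec m) : matrixCLM (clmMatrix T) = T := by
  refine ContinuousLinearMap.coe_injective
    ((EuclideanSpace.basisFun (Fin n) ℝ).toBasis.ext fun j => ?_)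
  ext i
  simp [clmMatrix, matrixCLM, Matrix.toLpLin_apply]

theorem matrixCLM_mul (A : Matrix (Fin m) (Fin n) ℝ) (B : Matrix (Fin n) (Fin p) ℝ) :
    matrixCLM (A * B) = (matrixCLM A).comp (matrixCLM B) := by
  ext v i
  simp [matrixCLM_apply, Matrix.toLpLin_apply, Matrix.mulVec_mulVec]

theorem clmMatrix_comp (S : Vec n →L[ℝ] Vec m) (T : Vec p →L[ℝ] Vec n) :
    clmMatrix (S.comp T) = clmMatrix S * clmMatrix T := by
  rw [← matrixCLM_clmMatrix S, ← matrixCLM_clmMatrix T, ← matrixCLM_mul]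
  simp only [clmMatrix_matrixCLM]

theorem clmMatrix_sub (S T : Vec n →L[ℝ] Vec m) :
    clmMatrix (S - T) = clmMatrix S - clmMatrix T := rfl

theorem continuous_matrixCLM :
    Continuous (matrixCLM : Matrix (Fin m) (Fin n) ℝ → Vec n →L[ℝ] Vec m) := by
  let l : Matrix (Fin m) (Fin n) ℝ →ₗ[ℝ] Vec n →L[ℝ] Vec m :=
    LinearMap.toContinuousLinearMap.toLinearMap ∘ₗ Matrix.toEuclideanLin.toLinearMap
  exact l.continuous_of_finiteDimensional

theorem hasFDerivAt_lurieField {A : Matrix (Fin n) (Fin n) ℝ} {B : Matrix (Fin n) (Fin m) ℝ}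
    {C : Matrix (Fin p) (Fin n) ℝ} {Φ : ℝ → Vec p → Vec m} {t : ℝ}
    (hΦ : Differentiable ℝ (Φ t)) (x : Vec n) :
    HasFDerivAt (lurieField A B C Φ t)
      (matrixCLM (A - B * jacobian (Φ t) (Matrix.toEuclideanLin C x) * C)) x := by
  have h1 := (hΦ (matrixCLM C x)).hasFDerivAt.comp x (matrixCLM C).hasFDerivAt
  have h2 := (matrixCLM A).hasFDerivAt.sub ((matrixCLM B).hasFDerivAt.comp x h1)
  refine h2.congr_fderiv ?_
  rw [← matrixCLM_clmMatrix (_ - _), clmMatrix_sub, clmMatrix_comp, clmMatrix_comp,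
    clmMatrix_matrixCLM, clmMatrix_matrixCLM, clmMatrix_matrixCLM, Matrix.mul_assoc]
  rfl

theorem jacobian_lurieField {A : Matrix (Fin n) (Fin n) ℝ} {B : Matrix (Fin n) (Fin m) ℝ}
    {C : Matrix (Fin p) (Fin n) ℝ} {Φ : ℝ → Vec p → Vec m} {t : ℝ}
    (hΦ : Differentiable ℝ (Φ t)) (x : Vec n) :
    jacobian (lurieField A B C Φ t) x =
      A - B * jacobian (Φ t) (Matrix.toEuclideanLin C x) * C := by
  change clmMatrix (fderiv ℝ (lurieField A B C Φ t) x) = _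
  rw [(hasFDerivAt_lurieField hΦ x).fderiv, clmMatrix_matrixCLM]

/-- Under the variational equation `Ẇ = J W`, the wedge product of the columns of `W` evolves by
the additive compound of `J`. -/
theorem hasDerivWithinAt_wedgeColumns {W : ℝ → Matrix (Fin n) (Fin k) ℝ}
    {J : Matrix (Fin n) (Fin n) ℝ} {s : Set ℝ} {t : ℝ}
    (hW : ∀ i j, HasDerivWithinAt (fun u => W u i j) ((J * W t) i j) s t) (κ : Seq k n) :
    HasDerivWithinAt (fun u => wedgeColumns (W u) κ)
      ((addCompound k J *ᵥ wedgeColumns (W t)) κ) s t := by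
  let g : (Fin n → Fin k → ℝ) → ℝ := fun X => wedgeColumns (Matrix.of X) κ
  have hg : Differentiable ℝ g := differentiable_mulCompound_apply κ _
  have h1 : HasDerivWithinAt (fun u => fun i j => W u i j) (fun i j => (J * W t) i j) s t :=
    hasDerivWithinAt_pi.2 fun i => hasDerivWithinAt_pi.2 fun j => hW i j
  have h2 := (hg (fun i j => W t i j)).hasFDerivAt.comp_hasDerivWithinAt t h1
  -- The same directional derivative of `g` is computed along the line `W + εJW = (I + εJ) W`, whose
  -- wedge is `(I + εJ)^{(k)} W^{(k)}`.
  have h3 : HasDerivAt (fun (ε : ℝ) i j => W t i j + ε * (J * W t) i j)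
      (fun i j => (J * W t) i j) 0 :=
    hasDerivAt_pi.2 fun i => hasDerivAt_pi.2 fun j => by
      simpa using ((hasDerivAt_id (0 : ℝ)).mul_const ((J * W t) i j)).const_add (W t i j)
  have h4 := (hg (fun i j => W t i j + (0 : ℝ) * (J * W t) i j)).hasFDerivAt.comp_hasDerivAt
    (0 : ℝ) h3
  simp only [zero_mul, add_zero] at h4
  have h5 : HasDerivAt (fun ε : ℝ => ∑ l, mulCompound k (1 + ε • J) κ l * wedgeColumns (W t) l)
      (∑ l, addCompound k J κ l * wedgeColumns (W t) l) 0 :=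
    HasDerivAt.fun_sum fun l _ => (hasDerivAt_mulCompound_one_add J κ l).mul_const _
  have h6 : (g ∘ fun (ε : ℝ) i j => W t i j + ε * (J * W t) i j) =
      fun ε : ℝ => ∑ l, mulCompound k (1 + ε • J) κ l * wedgeColumns (W t) l := by
    ext ε
    have : wedgeColumns ((1 + ε • J) * W t) κ =
        ∑ l, mulCompound k (1 + ε • J) κ l * wedgeColumns (W t) l := by
      rw [wedgeColumns_mul]
      rfl
    rw [← this, Matrix.add_mul, Matrix.one_mul, Matrix.smul_mul]
    rfl
  rw [h6] at h4
  rw [h4.unique h5] at h2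
  exact h2

/-- A Lyapunov inequality along a linear equation makes the scaled norm decay. -/
theorem scaledNorm_le_exp_mul {ι : Type} [Fintype ι] {H : Matrix ι ι ℝ} {M : ℝ → Matrix ι ι ℝ}
    {y : ℝ → ι → ℝ} {η a b : ℝ}
    (hM : ∀ t ∈ Icc a b, ∀ z,
      2 * ((H *ᵥ z) ⬝ᵥ (H *ᵥ M t *ᵥ z)) ≤ -η * ((H *ᵥ z) ⬝ᵥ (H *ᵥ z)))
    (hy : ∀ t ∈ Icc a b, ∀ i, HasDerivWithinAt (fun u => y u i) ((M t *ᵥ y t) i) (Icc a b) t)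
    {t : ℝ} (ht : t ∈ Icc a b) :
    scaledNorm H (y t) ≤ Real.exp (-(η / 2) * (t - a)) * scaledNorm H (y a) := by
  have hHy : ∀ t ∈ Icc a b, ∀ i, HasDerivWithinAt (fun u => (H *ᵥ y u) i)
      ((H *ᵥ M t *ᵥ y t) i) (Icc a b) t := fun t ht i =>
    HasDerivWithinAt.fun_sum fun j _ => (hy t ht j).const_mul (H i j)
  have hv : ∀ t ∈ Icc a b, HasDerivWithinAt (fun u => (H *ᵥ y u) ⬝ᵥ (H *ᵥ y u))
      (2 * ((H *ᵥ y t) ⬝ᵥ (H *ᵥ M t *ᵥ y t))) (Icc a b) t := by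
    intro t ht
    have h := HasDerivWithinAt.fun_sum (u := Finset.univ) fun i _ =>
      (hHy t ht i).fun_mul (hHy t ht i)
    refine h.congr_deriv ?_
    rw [dotProduct, Finset.mul_sum]
    exact Finset.sum_congr rfl fun i _ => by ring
  have hw : ∀ t ∈ Icc a b, HasDerivWithinAt
      (fun u => Real.exp (η * (u - a)) * ((H *ᵥ y u) ⬝ᵥ (H *ᵥ y u)))
      (Real.exp (η * (t - a)) * (η * ((H *ᵥ y t) ⬝ᵥ (H *ᵥ y t)) +
        2 * ((H *ᵥ y t) ⬝ᵥ (H *ᵥ M t *ᵥ y t)))) (Icc a b) t := by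
    intro t ht
    have h1 : HasDerivAt (fun u => Real.exp (η * (u - a))) (Real.exp (η * (t - a)) * η) t := by
      simpa using (((hasDerivAt_id t).sub_const a).const_mul η).exp
    exact (h1.hasDerivWithinAt.fun_mul (hv t ht)).congr_deriv (by ring)
  have hanti : AntitoneOn (fun u => Real.exp (η * (u - a)) * ((H *ᵥ y u) ⬝ᵥ (H *ᵥ y u)))
      (Icc a b) := by
    refine antitoneOn_of_hasDerivWithinAt_nonpos (convex_Icc a b)
      (fun t ht => (hw t ht).continuousWithinAt)
      (fun t ht => (hw t (interior_subset ht)).mono interior_subset) fun t ht => ?_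
    refine mul_nonpos_of_nonneg_of_nonpos (Real.exp_pos _).le ?_
    have := hM t (interior_subset ht) (y t)
    linarith
  have hle := hanti (left_mem_Icc.2 (ht.1.trans ht.2)) ht ht.1
  simp only [sub_self, mul_zero, Real.exp_zero, one_mul, dotProduct_self_eq_norm_sq] at hle
  unfold scaledNorm
  refine le_of_sq_le_sq ?_ (by positivity)
  rw [mul_pow, ← Real.exp_nat_mul]
  calc ‖WithLp.toLp 2 (H *ᵥ y t)‖ ^ 2
      = Real.exp (-(η * (t - a))) *
          (Real.exp (η * (t - a)) * ‖WithLp.toLp 2 (H *ᵥ y t)‖ ^ 2) := by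
        rw [← mul_assoc, ← Real.exp_add]
        simp
    _ ≤ Real.exp (-(η * (t - a))) * ‖WithLp.toLp 2 (H *ᵥ y a)‖ ^ 2 := by gcongr
    _ = _ := by
        congr 2
        push_cast
        ring

/-- Contraction of `k`-volumes along a smooth flow with bounded Jacobian `J t x`, from a Lyapunov
inequality for the additive compounds of `J t x`. -/
theorem isKContractive_of_lyapunov {f : ℝ → Vec n → Vec n}
    {J : ℝ → Vec n → Matrix (Fin n) (Fin n) ℝ} {H : Matrix (Seq k n) (Seq k n) ℝ} {η L : ℝ}
    (hη : 0 < η)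
    (hJ : ContinuousOn (fun z : ℝ × Vec n => J z.1 z.2) (Ici 0 ×ˢ univ))
    (hd : ∀ t : ℝ, 0 ≤ t → ∀ x, HasFDerivAt (f t) (matrixCLM (J t x)) x)
    (hL : ∀ t : ℝ, 0 ≤ t → ∀ x, ‖matrixCLM (J t x)‖ ≤ L)
    (hM : ∀ t : ℝ, 0 ≤ t → ∀ x z, 2 * ((H *ᵥ z) ⬝ᵥ (H *ᵥ addCompound k (J t x) *ᵥ z)) ≤
      -η * ((H *ᵥ z) ⬝ᵥ (H *ᵥ z))) :
    IsKContractive k f (scaledNorm H) (η / 2) := by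
  refine ⟨half_pos hη, fun D hD t₀ t₁ ht₀ x hx hx₀ => ?_⟩
  have hL0 : 0 ≤ L := (norm_nonneg _).trans (hL 0 le_rfl 0)
  -- Differentiability and decay propagate over time steps of uniform length.
  have hstep : ∀ r ∈ D, ∀ a ∈ Icc t₀ t₁, ∀ b ∈ Icc t₀ t₁, a ≤ b → b - a ≤ 1 / (2 * L + 1) →
      ∀ W₀, HasFDerivWithinAt (fun s => x s a) W₀ D r →
      ∃ W₁, HasFDerivWithinAt (fun s => x s b) W₁ D r ∧
        scaledNorm H (wedgeColumns (clmMatrix W₁)) ≤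
          Real.exp (-(η / 2) * (b - a)) * scaledNorm H (wedgeColumns (clmMatrix W₀)) := by
    intro r hr a ha b hb hab hshort W₀ hW₀
    have hsub : Icc a b ⊆ Icc t₀ t₁ := Icc_subset_Icc ha.1 hb.2
    have hnn : ∀ u ∈ Icc a b, 0 ≤ u := fun u hu => ht₀.trans (hsub hu).1
    have hsol : ∀ s ∈ D, ∀ t ∈ Icc a b, HasDerivWithinAt (x s) (f t (x s t)) (Icc a b) t :=
      fun s hs t ht => (hx s hs t (hsub ht)).mono hsub
    have hf' : ContinuousOn (fun z : ℝ × Vec n => matrixCLM (J z.1 z.2)) (Icc a b ×ˢ univ) :=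
      continuous_matrixCLM.comp_continuousOn
        (hJ.mono (prod_mono (fun u hu => hnn u hu) subset_rfl))
    -- The variational equation is a linear equation on the space of linear maps, with coefficient
    -- `S ↦ J ∘ S` of norm at most `L`.
    have hT : ContinuousOn (fun t => ContinuousLinearMap.compL ℝ (Vec k) (Vec n) (Vec n)
        (matrixCLM (J t (x r t)))) (Icc a b) := by
      refine (ContinuousLinearMap.continuous _).comp_continuousOn
        (hf'.comp (f := fun t => (t, x r t)) ?_ fun t ht => ⟨ht, mem_univ _⟩)
      exact continuousOn_id.prodMk fun t ht => (hsol r hr t ht).continuousWithinAt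
    have hTL : ∀ t ∈ Icc a b, ‖ContinuousLinearMap.compL ℝ (Vec k) (Vec n) (Vec n)
        (matrixCLM (J t (x r t)))‖ ≤ L := by
      intro t ht
      refine ContinuousLinearMap.opNorm_le_bound _ hL0 fun S => ?_
      exact (ContinuousLinearMap.opNorm_comp_le _ S).trans
        (mul_le_mul_of_nonneg_right (hL t (hnn t ht) _) (norm_nonneg S))
    -- The `+ 1` in the step length `1 / (2 * L + 1)` covers `L = 0`.
    have hshort' : 2 * L * (b - a) ≤ 1 := by
      rw [le_div_iff₀ (by positivity)] at hshort
      linarith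
    obtain ⟨W, hWa, hW⟩ := exists_linear_solution_of_short hab hT hTL hshort' W₀
    rw [← hWa] at hW₀ ⊢
    refine ⟨W b, hasFDerivWithinAt_of_variational hf' (fun t ht => hd t (hnn t ht))
      (fun t ht => hL t (hnn t ht)) hr hsol hW hW₀ (right_mem_Icc.2 hab), ?_⟩
    refine scaledNorm_le_exp_mul (y := fun t => wedgeColumns (clmMatrix (W t)))
      (M := fun t => addCompound k (J t (x r t))) (fun t ht z => hM t (hnn t ht) _ z)
      (fun t ht κ => hasDerivWithinAt_wedgeColumns (W := fun u => clmMatrix (W u))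
        (fun i j => ?_) κ) (right_mem_Icc.2 hab)
    have h1 := (hW t ht).clm_apply
      (hasDerivWithinAt_const t (Icc a b) (EuclideanSpace.single j (1 : ℝ)))
    have h2 := (EuclideanSpace.proj (𝕜 := ℝ) i).hasFDerivAt.comp_hasDerivWithinAt t h1
    refine h2.congr_deriv ?_
    rw [← clmMatrix_matrixCLM (J t (x r t)), ← clmMatrix_comp, clmMatrix_matrixCLM]
    simp [clmMatrix]
  have hprop : ∀ N : ℕ, ∀ r ∈ D, ∀ t ∈ Icc t₀ t₁, t - t₀ ≤ N * (1 / (2 * L + 1)) →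
      ∃ W₁, HasFDerivWithinAt (fun s => x s t) W₁ D r ∧
        scaledNorm H (wedgeColumns (clmMatrix W₁)) ≤ Real.exp (-(η / 2) * (t - t₀)) *
          scaledNorm H (wedgeColumns (jacobianWithin (fun s => x s t₀) D r)) := by
    intro N
    induction N with
    | zero =>
      intro r hr t ht htN
      have : t = t₀ := le_antisymm (by simpa using htN) ht.1
      subst this
      refine ⟨_, (hx₀ r hr).hasFDerivWithinAt, ?_⟩
      simp only [sub_self, mul_zero, Real.exp_zero, one_mul]
      exact le_rfl
    | succ N ih =>
      intro r hr t ht htN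
      set h := 1 / (2 * L + 1) with hh
      have hpos : 0 < h := by positivity
      -- One step back from `t`, but never before `t₀`.
      have ht' : max t₀ (t - h) ∈ Icc t₀ t₁ :=
        ⟨le_max_left _ _, max_le (ht.1.trans ht.2) (by linarith [ht.2])⟩
      push_cast at htN
      obtain ⟨W, hW, hWle⟩ := ih r hr _ ht' (by
        rcases max_cases t₀ (t - h) with hc | hc
        · rw [hc.1, sub_self]
          positivity
        · rw [hc.1]
          linarith)
      obtain ⟨W₁, hW₁, hW₁le⟩ := hstep r hr _ ht' t ht (max_le ht.1 (by linarith))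
        (by linarith [le_max_right t₀ (t - h)]) W hW
      refine ⟨W₁, hW₁, hW₁le.trans ?_⟩
      calc _ ≤ Real.exp (-(η / 2) * (t - max t₀ (t - h))) *
            (Real.exp (-(η / 2) * (max t₀ (t - h) - t₀)) *
              scaledNorm H (wedgeColumns (jacobianWithin (fun s => x s t₀) D r))) := by gcongr
        _ = _ := by
            rw [← mul_assoc, ← Real.exp_add]
            congr 2
            ring
  intro t ht
  obtain ⟨N, hN⟩ := exists_nat_ge ((t - t₀) / (1 / (2 * L + 1)))
  rw [div_le_iff₀ (by positivity)] at hN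
  refine ⟨fun r hr => ?_, fun r hr => ?_⟩
  · obtain ⟨W, hW, -⟩ := hprop N r hr t ht hN
    exact hW.differentiableWithinAt
  · obtain ⟨W, hW, hle⟩ := hprop N r hr t ht hN
    -- Uniqueness of derivatives within `D` identifies the propagated `W` with the Jacobian.
    rw [← hW.fderivWithin (hD r hr)] at hle
    exact hle

end Contraction

end Lurie

end

/-! ### The main theorem. -/

theorem mainTheorem2 {n m p : ℕ} (k : ℕ) (hk : 1 ≤ k) (hkn : k ≤ n)
    (A : Matrix (Fin n) (Fin n) ℝ) (B : Matrix (Fin n) (Fin m) ℝ) (C : Matrix (Fin p) (Fin n) ℝ)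
    (Φ : ℝ → Lurie.Vec p → Lurie.Vec m)
    (hΦ : ContinuousOn (fun z : ℝ × Lurie.Vec p => Φ z.1 z.2) (Set.Ici 0 ×ˢ Set.univ))
    (hΦd : ∀ t : ℝ, 0 ≤ t → Differentiable ℝ (Φ t))
    (hΦJ : ContinuousOn (fun z : ℝ × Lurie.Vec p => Lurie.jacobian (Φ z.1) z.2)
      (Set.Ici 0 ×ˢ Set.univ))
    (q : ℝ) (hq : ∀ t : ℝ, 0 ≤ t → ∀ y : Lurie.Vec p, Lurie.sigmaOne (Lurie.jacobian (Φ t) y) ≤ q)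
    (η₁ : ℝ) (hη₁ : 0 < η₁)
    (P Q : Matrix (Fin n) (Fin n) ℝ) (hQ : Q.PosDef) (hP : P = Q * Q)
    (hARI : Lurie.KARI k A B C P Q η₁ (q ^ 2) ∨
      (1 ≤ q ∧ Lurie.KARI k A B C P Q η₁ (q ^ (2 * k)))) :
    Lurie.IsKContractive k (Lurie.lurieField A B C Φ)
      (Lurie.scaledNorm (Lurie.mulCompound k Q)) (η₁ / 2) ∧
    ∀ t : ℝ, 0 ≤ t → ∀ x : Lurie.Vec n, ∃ μ : ℝ,
      Lurie.IsMatrixMeasure (Lurie.scaledNorm (Lurie.mulCompound k Q))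
        (Lurie.addCompound k (Lurie.jacobian (Lurie.lurieField A B C Φ t) x)) μ ∧
      μ ≤ -(η₁ / 2) := by
  subst hP
  have hK : Lurie.KARI k A B C (Q * Q) Q η₁ (q ^ 2) := by
    rcases hARI with h | ⟨h1, h⟩
    · exact h
    -- `q² ≤ q^{2k}` because `q ≥ 1` and `k ≥ 1`.
    · exact h.mono hQ (pow_le_pow_right₀ h1 (by omega))
  have hdet : IsUnit Q.det := (Matrix.isUnit_iff_isUnit_det _).1 hQ.isUnit
  constructor
  · refine Lurie.isKContractive_of_lyapunov
      (J := fun t x => A - B * Lurie.jacobian (Φ t) (Matrix.toEuclideanLin C x) * C)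
      (L := ‖Lurie.matrixCLM A‖ + ‖Lurie.matrixCLM B‖ * (q * ‖Lurie.matrixCLM C‖)) hη₁ ?_
      (fun t ht x => Lurie.hasFDerivAt_lurieField (hΦd t ht) x) (fun t ht x => ?_)
      (fun t ht x z => hK.two_mul_dotProduct_le hQ (hq t ht _) z)
    · have h1 : ContinuousOn (fun z : ℝ × Lurie.Vec n =>
          Lurie.jacobian (Φ z.1) (Matrix.toEuclideanLin C z.2)) (Set.Ici 0 ×ˢ Set.univ) :=
        hΦJ.comp (f := fun z : ℝ × Lurie.Vec n => (z.1, Lurie.matrixCLM C z.2))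
          (by fun_prop) fun z hz => ⟨hz.1, Set.mem_univ _⟩
      have h2 : Continuous fun K : Matrix (Fin m) (Fin p) ℝ => A - B * K * C :=
        continuous_const.sub
          ((continuous_const.matrix_mul continuous_id).matrix_mul continuous_const)
      exact h2.comp_continuousOn h1
    · have hq0 : 0 ≤ q := (Lurie.sigmaOne_nonneg _).trans (hq t ht 0)
      refine ContinuousLinearMap.opNorm_le_bound _ (by positivity) fun v => ?_
      have h1 : Lurie.matrixCLM
          (A - B * Lurie.jacobian (Φ t) (Matrix.toEuclideanLin C x) * C) v =
          Lurie.matrixCLM A v - Lurie.matrixCLM B (Matrix.toEuclideanLin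
            (Lurie.jacobian (Φ t) (Matrix.toEuclideanLin C x)) (Lurie.matrixCLM C v)) := by
        ext i
        simp [Lurie.matrixCLM_apply, Matrix.toLpLin_apply, Matrix.mulVec_mulVec]
      rw [h1]
      refine (norm_sub_le _ _).trans ?_
      rw [add_mul, mul_assoc, mul_assoc]
      gcongr
      · exact ContinuousLinearMap.le_opNorm _ _
      · refine (ContinuousLinearMap.le_opNorm _ _).trans ?_
        gcongr
        refine (Lurie.norm_toEuclideanLin_apply_le (hq t ht _) _).trans ?_
        gcongr
        exact ContinuousLinearMap.le_opNorm _ _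
  · intro t ht x
    -- With no index the identity would have norm `0`, and the quotient defining the matrix measure
    -- would diverge.
    have : Nonempty (Lurie.Seq k n) := ⟨Fin.castLEOrderEmb hkn⟩
    rw [Lurie.jacobian_lurieField (hΦd t ht)]
    exact Lurie.exists_isMatrixMeasure_le (Lurie.mulCompound_mul_inv hdet)
      (fun z => hK.two_mul_dotProduct_le hQ (hq t ht _) z)
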